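/- Let $\mathcal O,\mathcal A,\mathcal S$ be finite sets (observations, actions, agent states). An infinite-horizon discounted non-Markovian decision process consists of an initial law $\mu$ on $\mathcal O$, transition kernels $p_t(\cdot\mid o_{1:t},a_{1:t})$ on $\mathcal O$ and rewards $r_t(o_{1:t},a_{1:t})\in\mathbb R$ for $t\ge 1$, and a discount factor $\gamma\in(0,1)$. A stationary agent state-Markov (ASM) policy is a kernel $\pi(s,a\mid\tilde s,\tilde a,o)=\nu(s\mid\tilde s,\tilde a,o)\,\phi(a\mid s)$, where $\nu(\cdot\mid\tilde s,\tilde a,o)$ is a probability distribution on $\mathcal S$ and $\phi(\cdot\mid s)$ one on $\mathcal A$. Under $\pi$, with a fixed initial pair $(S_0,A_0)=(s_0,a_0)$, one has $O_1\sim\mu$, $(S_t,A_t)\sim\pi(\cdot,\cdot\mid S_{t-1},A_{t-1},O_t)$ and $O_{t+1}\sim p_t(\cdot\mid O_{1:t},A_{1:t})$ for all $t\ge1$; $\mathbb E_{\pi,\mu}$ is the expectation under the resulting law of the trajectory. Put $R^\gamma_{t:\infty}=\sum_{\ell=t}^\infty\gamma^{\ell-t}r_\ell(O_{1:\ell},A_{1:\ell})$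 and $Q^{\gamma,\pi}_t(o_{1:t},a_{0:t},s_t)=\mathbb E_{\pi,\mu}[R^\gamma_{t:\infty}\mid O_{1:t}=o_{1:t},A_{0:t}=a_{0:t},S_t=s_t]$. Let $\{\pi_\theta\mid\theta\in\mathbb R^d\}$ be a family of stationary ASM policies such that every $\pi_\theta(s,a\mid\tilde s,\tilde a,o)$ is differentiable in $\theta$ and the support of $\pi_\theta(\cdot,\cdot\mid\tilde s,\tilde a,o)$ does not depend on $\theta$. Suppose that there is $r_{\max}>0$ with $|r_t(\cdot)|\le r_{\max}$ for all $t\ge1$, and $G>0$ with $\|\nabla_\theta\log\pi_\theta(s,a\mid\tilde s,\tilde a,o)\|_2\le G$ for all $\theta\in\mathbb R^d$ and all $s,\tilde s,a,\tilde a,o$ with $\pi_\theta(s,a\mid\tilde s,\tilde a,o)>0$. Then $J_\gamma(\theta)=\mathbb E_{\pi_\theta,\mu}[R^\gamma_{1:\infty}]$ is differentiable on $\mathbb R^d$, and for every $\theta$ $$\nabla_\theta J_\gamma(\theta)=\mathbb E_{\pi_\theta,\mu}\Big[\sum_{t=1}^\infty\gamma^{t-1}R^\gamma_{t:\infty}\,\nabla_\theta\log\pi_\theta(S_t,A_t\mid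 S_{t-1},A_{t-1},O_t)\Big]$$ $$=\mathbb E_{\pi_\theta,\mu}\Big[\sum_{t=1}^\infty\gamma^{t-1}Q^{\gamma,\pi_\theta}_t(O_{1:t},A_{0:t},S_t)\,\nabla_\theta\log\pi_\theta(S_t,A_t\mid S_{t-1},A_{t-1},O_t)\Big],$$ where both series converge almost surely and their sums are integrable. -/

import Mathlib

open MeasureTheory ProbabilityTheory

noncomputable section

/-- An infinite-horizon discounted non-Markovian decision process with observations in `O` and
actions in `A`. Time is counted from `0` throughout: index `n` stands for the time
`t = n + 1 ≥ 1`, so that a function on `Finset.Iic n` is a sequence `x_1, …, x_{n+1}`.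
* `init` is the law of the first observation `O_1`;
* `trans n o a` is the law of `O_{t+1}` given `O_{1:t} = o`, `A_{1:t} = a`, where `t = n + 1`;
* `reward n o a` is the reward `r_t(o_{1:t}, a_{1:t})`, where `t = n + 1`;
* `γ` is the discount factor. -/
structure DiscountedNMDP (O A : Type*) where
  init : PMF O
  trans : (n : ℕ) → (Finset.Iic n → O) → (Finset.Iic n → A) → PMF O
  reward : (n : ℕ) → (Finset.Iic n → O) → (Finset.Iic n → A) → ℝ
  γ : ℝ
  γ_pos : 0 < γ
  γ_lt_one : γ < 1

/-- A stationary agent state-Markov (ASM) policy: `S_t ∼ ν(· ∣ S_{t-1}, A_{t-1}, O_t)` and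
`A_t ∼ φ(· ∣ S_t)`. -/
structure ASMPolicy (O S A : Type*) where
  ν : S → A → O → PMF S
  φ : S → PMF A

namespace ASMPolicy

variable {O S A : Type*}

/-- The combined kernel: `π.kernel s' a' o` is the law `π(·, · ∣ s', a', o)` of `(S_t, A_t)` given
`(S_{t-1}, A_{t-1}, O_t) = (s', a', o)`. -/
def kernel (π : ASMPolicy O S A) (s' : S) (a' : A) (o : O) : PMF (S × A) :=
  (π.ν s' a' o).bind fun s => (π.φ s).map fun a => (s, a)

/-- `π.prob s' a' o s a` is the real number `π(s, a ∣ s', a', o)`. -/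
def prob (π : ASMPolicy O S A) (s' : S) (a' : A) (o : O) (s : S) (a : A) : ℝ :=
  (π.kernel s' a' o (s, a)).toReal

/-- The combined kernel factorizes: `π(s, a ∣ s', a', o) = ν(s ∣ s', a', o) φ(a ∣ s)`. -/
theorem prob_eq_mul (π : ASMPolicy O S A) (s' : S) (a' : A) (o : O) (s : S) (a : A) :
    π.prob s' a' o s a = (π.ν s' a' o s).toReal * (π.φ s a).toReal := by
  classical
  rw [prob, kernel, PMF.bind_apply, ← ENNReal.toReal_mul]
  congr 1
  rw [tsum_eq_single s]
  · rw [PMF.map_apply, tsum_eq_single a]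
    · simp
    · intro b hb
      simp [Ne.symm hb]
  · intro t ht
    rw [PMF.map_apply]
    simp [Ne.symm ht]

end ASMPolicy

/-- The trajectories `(O_t, S_t, A_t)_{t ≥ 1}`; the entry with index `n` is
`(O_{n+1}, S_{n+1}, A_{n+1})`. -/
abbrev Trajectory (O S A : Type*) := ℕ → O × S × A

namespace Trajectory

variable {O S A : Type*}

/-- The observation `O_{n+1}`. -/
def obs (ω : Trajectory O S A) (n : ℕ) : O := (ω n).1

/-- The agent state `S_{n+1}`. -/
def state (ω : Trajectory O S A) (n : ℕ) : S := (ω n).2.1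

/-- The action `A_{n+1}`. -/
def act (ω : Trajectory O S A) (n : ℕ) : A := (ω n).2.2

/-- The previous agent state `S_n`, where `S_0 = s₀`. -/
def prevState (s₀ : S) (ω : Trajectory O S A) : ℕ → S
  | 0 => s₀
  | n + 1 => ω.state n

/-- The previous action `A_n`, where `A_0 = a₀`. -/
def prevAct (a₀ : A) (ω : Trajectory O S A) : ℕ → A
  | 0 => a₀
  | n + 1 => ω.act n

/-- The observations `O_{1:n+1}`. -/
def obsUpTo (ω : Trajectory O S A) (n : ℕ) : Finset.Iic n → O := fun i => ω.obs i

/-- The actions `A_{1:n+1}`. -/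
def actUpTo (ω : Trajectory O S A) (n : ℕ) : Finset.Iic n → A := fun i => ω.act i

end Trajectory

namespace DiscountedNMDP

variable {O S A : Type*}

/-- The law of `(O_t, S_t, A_t)` when `O_t` has law `q` and `(S_{t-1}, A_{t-1}) = (s', a')`:
first `O_t ∼ q`, then `(S_t, A_t) ∼ π(·, · ∣ s', a', O_t)`. -/
def stepPMF (π : ASMPolicy O S A) (q : PMF O) (s' : S) (a' : A) : PMF (O × S × A) :=
  q.bind fun o => (π.kernel s' a' o).map fun x => (o, x)

section Law

variable [Finite O] [MeasurableSpace O] [MeasurableSingletonClass O]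
  [Finite S] [MeasurableSpace S] [MeasurableSingletonClass S]
  [Finite A] [MeasurableSpace A] [MeasurableSingletonClass A]

/-- The conditional law of the trajectory entry with index `n + 1` given those up to `n`. -/
def stepKernel (M : DiscountedNMDP O A) (π : ASMPolicy O S A) (n : ℕ) :
    Kernel (Finset.Iic n → O × S × A) (O × S × A) :=
  Kernel.ofFunOfCountable fun h =>
    (stepPMF π (M.trans n (fun i => (h i).1) (fun i => (h i).2.2))
      (h ⟨n, Finset.mem_Iic.2 le_rfl⟩).2.1 (h ⟨n, Finset.mem_Iic.2 le_rfl⟩).2.2).toMeasure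

instance (M : DiscountedNMDP O A) (π : ASMPolicy O S A) (n : ℕ) :
    IsMarkovKernel (M.stepKernel π n) :=
  ⟨fun _ => PMF.toMeasure.isProbabilityMeasure _⟩

/-- The law of the trajectory under the policy `π` started with `(S_0, A_0) = (s₀, a₀)` and
`O_1 ∼ M.init` (the Ionescu-Tulcea measure). -/
def law (M : DiscountedNMDP O A) (s₀ : S) (a₀ : A) (π : ASMPolicy O S A) :
    Measure (Trajectory O S A) :=
  Kernel.trajMeasure (X := fun _ => O × S × A)
    (stepPMF π M.init s₀ a₀).toMeasure (fun n => M.stepKernel π n)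

instance (M : DiscountedNMDP O A) (s₀ : S) (a₀ : A) (π : ASMPolicy O S A) :
    IsProbabilityMeasure (M.law s₀ a₀ π) := by
  unfold law; infer_instance

end Law

/-- The discounted reward-to-go `R^γ_{t:∞} = ∑_{ℓ ≥ t} γ^{ℓ-t} r_ℓ(O_{1:ℓ}, A_{1:ℓ})` with
`t = n + 1`. The series converges absolutely when the rewards are bounded. -/
def rewardToGo (M : DiscountedNMDP O A) (n : ℕ) (ω : Trajectory O S A) : ℝ :=
  ∑' k : ℕ, M.γ ^ k * M.reward (n + k) (ω.obsUpTo (n + k)) (ω.actUpTo (n + k))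

section Value

variable [Finite O] [MeasurableSpace O] [MeasurableSingletonClass O]
  [Finite S] [MeasurableSpace S] [MeasurableSingletonClass S]
  [Finite A] [MeasurableSpace A] [MeasurableSingletonClass A]

/-- The expected discounted return `E_{π, μ}[R^γ_{1:∞}]`. -/
def value (M : DiscountedNMDP O A) (s₀ : S) (a₀ : A) (π : ASMPolicy O S A) : ℝ :=
  ∫ ω, M.rewardToGo 0 ω ∂(M.law s₀ a₀ π)

/-- The discounted Q-function
`Q_t(o_{1:t}, a_{0:t}, s_t) = E_π[R^γ_{t:∞} ∣ O_{1:t} = o_{1:t}, A_{0:t} = a_{0:t}, S_t = s_t]`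
with `t = n + 1`, as an elementary conditional expectation given an event; here `A_0` is the
constant `a₀`. -/
def qFunction (M : DiscountedNMDP O A) (s₀ : S) (a₀ : A) (π : ASMPolicy O S A) (n : ℕ)
    (o : Finset.Iic n → O) (a : Finset.Iic n → A) (s : S) : ℝ :=
  ∫ ω, M.rewardToGo n ω ∂(ProbabilityTheory.cond (M.law s₀ a₀ π)
    {ω | ω.obsUpTo n = o ∧ ω.actUpTo n = a ∧ ω.state n = s})

end Value

end DiscountedNMDP

/-- The score `∇_θ log π_θ(s, a ∣ s', a', o)` of a parameterized family of ASM policies. -/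
def ASMPolicy.score {O S A : Type*} {d : ℕ} (π : EuclideanSpace ℝ (Fin d) → ASMPolicy O S A)
    (θ : EuclideanSpace ℝ (Fin d)) (s' : S) (a' : A) (o : O) (s : S) (a : A) :
    EuclideanSpace ℝ (Fin d) :=
  gradient (fun θ' => Real.log ((π θ').prob s' a' o s a)) θ

/-- The score at time `t = n + 1` along a trajectory:
`∇_θ log π_θ(S_t, A_t ∣ S_{t-1}, A_{t-1}, O_t)`. -/
def Trajectory.score {O S A : Type*} {d : ℕ} (s₀ : S) (a₀ : A)
    (π : EuclideanSpace ℝ (Fin d) → ASMPolicy O S A) (θ : EuclideanSpace ℝ (Fin d)) (n : ℕ)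
    (ω : Trajectory O S A) : EuclideanSpace ℝ (Fin d) :=
  ASMPolicy.score π θ (ω.prevState s₀ n) (ω.prevAct a₀ n) (ω.obs n) (ω.state n) (ω.act n)

end

/-! The argument is the likelihood-ratio method. Rewards, initial law and transitions do not involve
`θ`, so the parameter enters the law of finitely many trajectory entries only through the policy
factors. Each such factor has derivative itself times its score. The product rule then gives, at a
finite horizon, that the gradient of `E[r_l]` is `E[r_l * ∑_{t ≤ l} score_t]`
(`hasGradientAt_integral_law`). Constancy of the support makes the identity hold at zero
probabilities too: these vanish for all `θ`, and so does their score.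

The value is `∑ γ^l E[r_l]`. The `l`-th gradient is bounded by `γ^l * C * (l + 1) * B` uniformly in
`θ`, which is summable, so the series may be differentiated termwise (`hasGradientAt_value_tsum`).
Summing over the triangle `t ≤ l` with `t` outermost collects the discounted rewards after `t` into
`γ^t R_t`; absolute convergence justifies the exchange (`hasGradientAt_value`).

For the Q-form, the score at `t` is a function of the past up to `t`, so `R_t` may be replaced by
its conditional mean given that past (`integral_rewardToGo_smul`). The entry after `t` is drawn from
a law that depends on the observations, the actions and the current agent state alone. Hence this
conditional mean is almost surely the Q-function (`qFunction_ae_eq`). -/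

/-- Summation over the triangle `t ≤ ℓ` by columns. -/
theorem tsum_sum_range_eq_tsum_tsum {E : Type*} [NormedAddCommGroup E] [CompleteSpace E]
    {f : ℕ → ℕ → E} (hf : Summable fun p : ℕ × ℕ => f p.1 p.2) :
    ∑' l, ∑ t ∈ Finset.range (l + 1), f t (l - t) = ∑' t, ∑' k, f t k := by
  have hs : Summable fun x : Σ n : ℕ, Finset.HasAntidiagonal.antidiagonal n =>
      f (x.2 : ℕ × ℕ).1 (x.2 : ℕ × ℕ).2 :=
    (Equiv.summable_iff (f := fun p : ℕ × ℕ => f p.1 p.2)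
      Finset.HasAntidiagonal.sigmaAntidiagonalEquivProd).2 hf
  have he : ∑' x : Σ n : ℕ, Finset.HasAntidiagonal.antidiagonal n,
      f (x.2 : ℕ × ℕ).1 (x.2 : ℕ × ℕ).2 =
      ∑' p : ℕ × ℕ, f p.1 p.2 :=
    Finset.HasAntidiagonal.sigmaAntidiagonalEquivProd.tsum_eq (fun p : ℕ × ℕ => f p.1 p.2)
  rw [← hf.tsum_prod, ← he, hs.tsum_sigma]
  refine tsum_congr fun l => ?_
  rw [tsum_fintype, ← Finset.Nat.sum_antidiagonal_eq_sum_range_succ f,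
    ← Finset.sum_coe_sort (Finset.HasAntidiagonal.antidiagonal l)]

theorem summable_geometric_add {γ : ℝ} (h0 : 0 ≤ γ) (h1 : γ < 1) (C : ℝ) :
    Summable fun p : ℕ × ℕ => γ ^ (p.1 + p.2) * C := by
  refine Summable.mul_right C ?_
  simpa only [pow_add] using
    (summable_geometric_of_lt_one h0 h1).mul_of_nonneg (summable_geometric_of_lt_one h0 h1)
      (fun _ => pow_nonneg h0 _) (fun _ => pow_nonneg h0 _)

/-! ### Integration of uniformly dominated series -/

section Integral

variable {Ω E : Type*} [MeasurableSpace Ω] {μ : Measure Ω} [IsFiniteMeasure μ]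
  [NormedAddCommGroup E] {f : ℕ → Ω → E} {u : ℕ → ℝ}

theorem MeasureTheory.integrable_tsum_of_norm_le [CompleteSpace E]
    (hm : ∀ n, StronglyMeasurable (f n))
    (hu : Summable u) (hb : ∀ n ω, ‖f n ω‖ ≤ u n) : Integrable (fun ω => ∑' n, f n ω) μ := by
  refine Integrable.of_bound (C := ∑' n, u n) ?_
    (.of_forall fun ω => tsum_of_norm_bounded hu.hasSum fun n => hb n ω)
  refine aestronglyMeasurable_of_tendsto_ae Filter.atTop
    (f := fun N ω => ∑ n ∈ Finset.range N, f n ω)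
    (fun N => (Finset.stronglyMeasurable_fun_sum _ fun n _ => hm n).aestronglyMeasurable)
    (.of_forall fun ω => ?_)
  exact (Summable.of_norm_bounded hu fun n => hb n ω).hasSum.tendsto_sum_nat

theorem MeasureTheory.integral_tsum_of_norm_le [NormedSpace ℝ E]
    (hm : ∀ n, StronglyMeasurable (f n))
    (hu : Summable u) (hb : ∀ n ω, ‖f n ω‖ ≤ u n) :
    ∫ ω, ∑' n, f n ω ∂μ = ∑' n, ∫ ω, f n ω ∂μ := by
  have hi : ∀ n, Integrable (f n) μ := fun n =>
    Integrable.of_bound (hm n).aestronglyMeasurable (u n) (.of_forall (hb n))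
  refine (integral_tsum_of_summable_integral_norm hi ?_).symm
  refine Summable.of_nonneg_of_le (fun n => integral_nonneg fun _ => norm_nonneg _)
    (fun n => ?_) (hu.mul_right (μ.real Set.univ))
  calc ∫ ω, ‖f n ω‖ ∂μ ≤ ∫ _, u n ∂μ :=
        integral_mono (hi n).norm (integrable_const _) (hb n)
    _ = u n * μ.real Set.univ := by simp [mul_comm]

theorem MeasureTheory.norm_integral_le_of_forall_norm_le {Ω E : Type*} [MeasurableSpace Ω]
    {μ : Measure Ω} [IsProbabilityMeasure μ] [NormedAddCommGroup E] [NormedSpace ℝ E]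
    {f : Ω → E} {C : ℝ} (h : ∀ ω, ‖f ω‖ ≤ C) : ‖∫ ω, f ω ∂μ‖ ≤ C := by
  simpa using norm_integral_le_of_norm_le_const (μ := μ) (.of_forall h)

end Integral

/-! ### Calculus of gradients -/

section Gradient

variable {F : Type*} [NormedAddCommGroup F] [InnerProductSpace ℝ F] [CompleteSpace F]

theorem HasGradientAt.fun_mul {f g : F → ℝ} {f' g' x : F} (hf : HasGradientAt f f' x)
    (hg : HasGradientAt g g' x) :
    HasGradientAt (fun y => f y * g y) (f x • g' + g x • f') x := by
  have hf₁ := hf.hasFDerivAt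
  have hg₁ := hg.hasFDerivAt
  rw [hasGradientAt_iff_hasFDerivAt]
  exact (hf₁.mul hg₁).congr_fderiv (by simp)

theorem HasGradientAt.fun_sum {ι : Type*} {s : Finset ι} {f : ι → F → ℝ} {f' : ι → F} {x : F}
    (hf : ∀ i ∈ s, HasGradientAt (f i) (f' i) x) :
    HasGradientAt (fun y => ∑ i ∈ s, f i y) (∑ i ∈ s, f' i) x := by
  rw [hasGradientAt_iff_hasFDerivAt]
  exact (HasFDerivAt.fun_sum fun i hi => (hf i hi).hasFDerivAt).congr_fderiv (by simp)

/-- The Riesz map `toDual` is an isometry, so the bounds carry over to Fréchet derivatives; being a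
continuous linear equivalence, it commutes with `tsum`. -/
theorem hasGradientAt_tsum {ι : Type*} {f : ι → F → ℝ} {f' : ι → F → F} {u : ι → ℝ}
    (hu : Summable u) (hf : ∀ n x, HasGradientAt (f n) (f' n x) x)
    (hf' : ∀ n x, ‖f' n x‖ ≤ u n) {x₀ : F} (hf0 : Summable fun n => f n x₀) (x : F) :
    HasGradientAt (fun y => ∑' n, f n y) (∑' n, f' n x) x := by
  rw [hasGradientAt_iff_hasFDerivAt]
  refine (hasFDerivAt_tsum hu (fun n x => (hf n x).hasFDerivAt)
    (fun n x => by simpa using hf' n x) hf0 x).congr_fderiv ?_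
  exact ((InnerProductSpace.toDual ℝ F).toContinuousLinearEquiv.map_tsum
    (f := fun n => f' n x)).symm

/-- A function that is differentiable, and either positive everywhere or zero everywhere, is the
product with its logarithmic gradient. -/
theorem hasGradientAt_smul_gradient_log {p : F → ℝ} (hp : Differentiable ℝ p) {x : F}
    (h : p x = 0 → ∀ y, p y = 0) :
    HasGradientAt p (p x • gradient (fun y => Real.log (p y)) x) x := by
  by_cases hx : p x = 0
  · have : p = fun _ => 0 := funext (h hx)
    subst this
    simpa using hasGradientAt_const x (0 : ℝ)
  · rw [hasGradientAt_iff_hasFDerivAt, map_smul, toDual_gradient,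
      ((hp x).hasFDerivAt.log hx).fderiv, smul_inv_smul₀ hx]
    exact (hp x).hasFDerivAt

end Gradient

/-! ### Functions of finitely many entries -/

section DependsOn

variable {X : Type*}

/-- A function of a sequence that depends on the entries up to `n` only is a function of its
restriction. -/
theorem DependsOn.eq_comp_frestrictLe {β : Type*} {f : (ℕ → X) → β} {n : ℕ}
    (hf : DependsOn f (Set.Iic n)) (ω : ℕ → X) :
    f ω = f (fun i => Preorder.frestrictLe (π := fun _ => X) n ω
      ⟨min i n, Finset.mem_Iic.2 (min_le_right _ _)⟩) := by
  -- The prefix is extended by repeating its last entry, so no default element of `X` is needed.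
  refine hf fun i hi => ?_
  simp [min_eq_left (Set.mem_Iic.1 hi)]

theorem DependsOn.comp_left₂ {ι β β' δ : Type*} {f : (ι → X) → β} {f' : (ι → X) → β'} {s : Set ι}
    (hf : DependsOn f s) (hf' : DependsOn f' s) (g : β → β' → δ) :
    DependsOn (fun ω => g (f ω) (f' ω)) s := fun _ _ h => congrArg₂ g (hf h) (hf' h)

theorem DependsOn.fun_sum {ι κ E : Type*} [AddCommMonoid E] {s : Set ι} {t : Finset κ}
    {f : κ → (ι → X) → E} (hf : ∀ k ∈ t, DependsOn (f k) s) :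
    DependsOn (fun ω => ∑ k ∈ t, f k ω) s :=
  fun _ _ h => Finset.sum_congr rfl fun k hk => hf k hk h

variable [Finite X] [MeasurableSpace X] [MeasurableSingletonClass X]

/-- Such a function factors through the finite discrete space of prefixes, on which every function
is measurable. -/
theorem DependsOn.stronglyMeasurable {β : Type*} [TopologicalSpace β]
    {f : (ℕ → X) → β} {n : ℕ} (hf : DependsOn f (Set.Iic n)) : StronglyMeasurable f := by
  rw [funext hf.eq_comp_frestrictLe]
  exact StronglyMeasurable.comp_measurable (f := fun h : Finset.Iic n → X =>
    f fun i => h ⟨min i n, Finset.mem_Iic.2 (min_le_right _ _)⟩) (.of_discrete)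
    (Preorder.measurable_frestrictLe n)

theorem DependsOn.measurable {β : Type*} [MeasurableSpace β]
    {f : (ℕ → X) → β} {n : ℕ} (hf : DependsOn f (Set.Iic n)) : Measurable f := by
  rw [funext hf.eq_comp_frestrictLe]
  exact Measurable.comp (g := fun h : Finset.Iic n → X =>
    f fun i => h ⟨min i n, Finset.mem_Iic.2 (min_le_right _ _)⟩) (.of_discrete)
    (Preorder.measurable_frestrictLe n)

theorem DependsOn.integrable {E : Type*} [NormedAddCommGroup E] {f : (ℕ → X) → E} {n : ℕ}
    (hf : DependsOn f (Set.Iic n)) (μ : Measure (ℕ → X)) [IsFiniteMeasure μ] :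
    Integrable f μ := by
  rw [funext hf.eq_comp_frestrictLe]
  exact Integrable.comp_measurable (g := fun h : Finset.Iic n → X =>
    f fun i => h ⟨min i n, Finset.mem_Iic.2 (min_le_right _ _)⟩) (.of_finite)
    (Preorder.measurable_frestrictLe n)

end DependsOn

/-! ### One-step disintegration of the Ionescu-Tulcea measure -/

section TrajMeasure

variable {X : Type*} [Finite X] [MeasurableSpace X] [MeasurableSingletonClass X]
  {E : Type*} [NormedAddCommGroup E] [NormedSpace ℝ E] {f : (ℕ → X) → E}
  (μ₀ : Measure X) (κ : (n : ℕ) → Kernel (Finset.Iic n → X) X)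
  [∀ n, IsMarkovKernel (κ n)]

theorem ProbabilityTheory.Kernel.integral_trajMeasure_zero (hf : DependsOn f (Set.Iic 0)) :
    ∫ ω, f ω ∂(trajMeasure (X := fun _ => X) μ₀ κ) = ∫ x, f (fun _ => x) ∂μ₀ := by
  have hmap : (trajMeasure (X := fun _ => X) μ₀ κ).map (Preorder.frestrictLe 0) =
      μ₀.map (MeasurableEquiv.piUnique (fun _ : Finset.Iic 0 => X)).symm := by
    rw [trajMeasure, Measure.map_comp _ _ (by fun_prop), traj_map_frestrictLe, partialTraj_self,
      Measure.id_comp]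
  calc ∫ ω, f ω ∂(trajMeasure (X := fun _ => X) μ₀ κ)
      = ∫ h, f (fun i => h ⟨min i 0, Finset.mem_Iic.2 (min_le_right _ _)⟩)
          ∂((trajMeasure (X := fun _ => X) μ₀ κ).map (Preorder.frestrictLe 0)) := by
        rw [integral_map (by fun_prop) (StronglyMeasurable.of_discrete).aestronglyMeasurable]
        exact integral_congr_ae (.of_forall hf.eq_comp_frestrictLe)
    _ = ∫ x, f (fun _ => x) ∂μ₀ := by
        rw [hmap, integral_map (by fun_prop) (StronglyMeasurable.of_discrete).aestronglyMeasurable]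
        rfl

/-- The joint law of the prefix and the next entry is the composition product of the law of the
prefix with `κ n`; Fubini for this product gives the inner integral. -/
theorem ProbabilityTheory.Kernel.integral_trajMeasure_succ
    [IsProbabilityMeasure μ₀] {n : ℕ}
    (hf : DependsOn f (Set.Iic (n + 1))) :
    ∫ ω, f ω ∂(trajMeasure (X := fun _ => X) μ₀ κ) =
      ∫ ω, ∫ x, f (Function.update ω (n + 1) x) ∂(κ n (Preorder.frestrictLe n ω))
        ∂(trajMeasure (X := fun _ => X) μ₀ κ) := by
  set μ := trajMeasure (X := fun _ => X) μ₀ κ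
  -- Passing to prefix and next entry puts the integrand on a finite space, where measurability and
  -- integrability are automatic.
  let Φ : (Finset.Iic n → X) × X → E := fun p => f (Function.update
    (fun i => p.1 ⟨min i n, Finset.mem_Iic.2 (min_le_right _ _)⟩) (n + 1) p.2)
  have hΦ : ∀ ω x, Φ (Preorder.frestrictLe n ω, x) = f (Function.update ω (n + 1) x) := by
    intro ω x
    refine hf fun i hi => ?_
    rcases eq_or_ne i (n + 1) with rfl | hne
    · simp
    · have : i ≤ n := by have := Set.mem_Iic.1 hi; omega
      simp [Function.update_of_ne hne, min_eq_left this]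
  calc ∫ ω, f ω ∂μ = ∫ ω, Φ (Preorder.frestrictLe n ω, ω (n + 1)) ∂μ := by
        simp [hΦ]
    _ = ∫ p, Φ p ∂(μ.map (Preorder.frestrictLe n) ⊗ₘ κ n) := by
        rw [map_frestrictLe_trajMeasure_compProd_eq_map_trajMeasure,
          integral_map (by fun_prop) (StronglyMeasurable.of_discrete).aestronglyMeasurable]
    _ = _ := by
        rw [Measure.integral_compProd .of_finite,
          integral_map (by fun_prop) (StronglyMeasurable.of_discrete).aestronglyMeasurable]
        simp only [hΦ]

end TrajMeasure

noncomputable section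

/-! ### Scores, rewards and transition laws along a trajectory -/

section Dependence

variable {O S A : Type*} {n m : ℕ}

namespace Trajectory

theorem dependsOn_obs (h : n ≤ m) :
    DependsOn (fun ω : Trajectory O S A => ω.obs n) (Set.Iic m) :=
  fun _ _ hω => congrArg Prod.fst (hω n h)

theorem dependsOn_state (h : n ≤ m) :
    DependsOn (fun ω : Trajectory O S A => ω.state n) (Set.Iic m) :=
  fun _ _ hω => congrArg (fun x => x.2.1) (hω n h)

theorem dependsOn_act (h : n ≤ m) :
    DependsOn (fun ω : Trajectory O S A => ω.act n) (Set.Iic m) :=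
  fun _ _ hω => congrArg (fun x => x.2.2) (hω n h)

theorem dependsOn_obsUpTo (h : n ≤ m) :
    DependsOn (fun ω : Trajectory O S A => ω.obsUpTo n) (Set.Iic m) :=
  fun _ _ hω => funext fun i => dependsOn_obs ((Finset.mem_Iic.1 i.2).trans h) hω

theorem dependsOn_actUpTo (h : n ≤ m) :
    DependsOn (fun ω : Trajectory O S A => ω.actUpTo n) (Set.Iic m) :=
  fun _ _ hω => funext fun i => dependsOn_act ((Finset.mem_Iic.1 i.2).trans h) hω

theorem dependsOn_score {d : ℕ} (s₀ : S) (a₀ : A)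
    (π : EuclideanSpace ℝ (Fin d) → ASMPolicy O S A) (θ : EuclideanSpace ℝ (Fin d)) (h : n ≤ m) :
    DependsOn (fun ω : Trajectory O S A => ω.score s₀ a₀ π θ n) (Set.Iic m) := by
  intro ω ω' hω
  simp only [Trajectory.score]
  cases n with
  | zero => simp only [prevState, prevAct, obs, state, act, hω 0 h]
  | succ k =>
    simp only [prevState, prevAct, obs, state, act, hω (k + 1) h, hω k ((Nat.le_succ k).trans h)]

end Trajectory

namespace DiscountedNMDP

/-- The reward at time `t = n + 1` along a trajectory. -/
def rewardAt (M : DiscountedNMDP O A) (n : ℕ) (ω : Trajectory O S A) : ℝ :=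
  M.reward n (ω.obsUpTo n) (ω.actUpTo n)

theorem dependsOn_rewardAt (M : DiscountedNMDP O A) (h : n ≤ m) :
    DependsOn (M.rewardAt (S := S) n) (Set.Iic m) :=
  (Trajectory.dependsOn_obsUpTo h).comp_left₂ (Trajectory.dependsOn_actUpTo h) (M.reward n)

theorem rewardToGo_eq (M : DiscountedNMDP O A) (ω : Trajectory O S A) :
    M.rewardToGo n ω = ∑' k, M.γ ^ k * M.rewardAt (n + k) ω := rfl

/-- The conditional law of the trajectory entry with index `n + 1` given those up to `n`. -/
def nextLaw (M : DiscountedNMDP O A) (π : ASMPolicy O S A) (n : ℕ) (ω : Trajectory O S A) :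
    PMF (O × S × A) :=
  stepPMF π (M.trans n (ω.obsUpTo n) (ω.actUpTo n)) (ω.state n) (ω.act n)

/-- Earlier agent states do not matter: this is the Markov property behind the Q-function. -/
theorem nextLaw_congr (M : DiscountedNMDP O A) (π : ASMPolicy O S A) {ω ω' : Trajectory O S A}
    (ho : ω.obsUpTo n = ω'.obsUpTo n) (ha : ω.actUpTo n = ω'.actUpTo n)
    (hs : ω.state n = ω'.state n) : M.nextLaw π n ω = M.nextLaw π n ω' := by
  have : ω.act n = ω'.act n := congrFun ha ⟨n, Finset.mem_Iic.2 le_rfl⟩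
  rw [nextLaw, nextLaw, ho, ha, hs, this]

theorem stepPMF_apply_toReal (π : ASMPolicy O S A) (q : PMF O) (s' : S) (a' : A) (x : O × S × A) :
    (stepPMF π q s' a' x).toReal = (q x.1).toReal * π.prob s' a' x.1 x.2.1 x.2.2 := by
  classical
  obtain ⟨o, y⟩ := x
  rw [stepPMF, PMF.bind_apply, ASMPolicy.prob, ← ENNReal.toReal_mul]
  congr 1
  rw [tsum_eq_single o]
  · rw [PMF.map_apply, tsum_eq_single y]
    · simp
    · intro b hb
      simp [Ne.symm hb]
  · intro t ht
    rw [PMF.map_apply]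
    simp [Ne.symm ht]

end DiscountedNMDP

end Dependence

/-! ### One-step conditional expectations and mean rewards -/

namespace DiscountedNMDP

variable {O S A : Type*} [Fintype O] [Fintype S] [Fintype A]
  {E : Type*} [NormedAddCommGroup E] [NormedSpace ℝ E] {n : ℕ}

/-- The conditional expectation, given the entries up to `n`, of a function of the entries up to
`n + 1`. -/
def nextMean (M : DiscountedNMDP O A) (π : ASMPolicy O S A) (n : ℕ) (f : Trajectory O S A → E)
    (ω : Trajectory O S A) : E :=
  ∑ x, (M.nextLaw π n ω x).toReal • f (Function.update ω (n + 1) x)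

theorem update_eq_of_eq {X : Type*} {ω ω' : ℕ → X} (h : ∀ i ≤ n, ω i = ω' i) (x : X) :
    ∀ i ∈ Set.Iic (n + 1),
      Function.update ω (n + 1) x i = Function.update ω' (n + 1) x i := by
  intro i hi
  rcases eq_or_ne i (n + 1) with rfl | hne
  · simp
  · have : i ≤ n := by have := Set.mem_Iic.1 hi; omega
    simp [Function.update_of_ne hne, h i this]

theorem dependsOn_nextMean (M : DiscountedNMDP O A) (π : ASMPolicy O S A)
    {f : Trajectory O S A → E} (hf : DependsOn f (Set.Iic (n + 1))) :
    DependsOn (M.nextMean π n f) (Set.Iic n) := by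
  intro ω ω' h
  refine Finset.sum_congr rfl fun x _ => ?_
  rw [M.nextLaw_congr π (Trajectory.dependsOn_obsUpTo le_rfl h)
    (Trajectory.dependsOn_actUpTo le_rfl h) (Trajectory.dependsOn_state le_rfl h),
    hf (update_eq_of_eq h x)]

/-- Taking out what is known: the update at `n + 1` does not affect `g`. -/
theorem nextMean_smul (M : DiscountedNMDP O A) (π : ASMPolicy O S A) (f : Trajectory O S A → ℝ)
    {g : Trajectory O S A → E} (hg : DependsOn g (Set.Iic n)) (ω : Trajectory O S A) :
    M.nextMean π n (fun ω => f ω • g ω) ω = M.nextMean π n f ω • g ω := by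
  rw [nextMean, nextMean, Finset.sum_smul]
  refine Finset.sum_congr rfl fun x _ => ?_
  have : g (Function.update ω (n + 1) x) = g ω := hg fun i hi =>
    Function.update_of_ne (by have := Set.mem_Iic.1 hi; omega) _ _
  rw [this, smul_assoc]

theorem sum_toReal_pmf {X : Type*} [Fintype X] (p : PMF X) : ∑ x, (p x).toReal = 1 := by
  rw [← ENNReal.toReal_sum fun x _ => p.apply_ne_top x,
    ← tsum_fintype (L := .unconditional X), p.tsum_coe,
    ENNReal.toReal_one]

theorem norm_nextMean_le (M : DiscountedNMDP O A) (π : ASMPolicy O S A)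
    {f : Trajectory O S A → E} {C : ℝ} (hf : ∀ ω, ‖f ω‖ ≤ C) (ω : Trajectory O S A) :
    ‖M.nextMean π n f ω‖ ≤ C := by
  calc ‖M.nextMean π n f ω‖ ≤ ∑ x, (M.nextLaw π n ω x).toReal * C := by
        refine norm_sum_le_of_le _ fun x _ => ?_
        rw [norm_smul, Real.norm_of_nonneg ENNReal.toReal_nonneg]
        exact mul_le_mul_of_nonneg_left (hf _) ENNReal.toReal_nonneg
    _ = C := by rw [← Finset.sum_mul, sum_toReal_pmf, one_mul]

variable [MeasurableSpace O] [MeasurableSingletonClass O]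
  [MeasurableSpace S] [MeasurableSingletonClass S]
  [MeasurableSpace A] [MeasurableSingletonClass A]

theorem integral_law_zero [CompleteSpace E] (M : DiscountedNMDP O A) (s₀ : S) (a₀ : A)
    (π : ASMPolicy O S A)
    {f : Trajectory O S A → E} (hf : DependsOn f (Set.Iic 0)) :
    ∫ ω, f ω ∂(M.law s₀ a₀ π) =
      ∑ x, (stepPMF π M.init s₀ a₀ x).toReal • f (fun _ => x) := by
  rw [law, Kernel.integral_trajMeasure_zero _ _ hf, PMF.integral_eq_sum]

/-- The tower property for one step. -/
theorem integral_law_succ [CompleteSpace E] (M : DiscountedNMDP O A) (s₀ : S) (a₀ : A)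
    (π : ASMPolicy O S A)
    {f : Trajectory O S A → E} (hf : DependsOn f (Set.Iic (n + 1))) :
    ∫ ω, f ω ∂(M.law s₀ a₀ π) = ∫ ω, M.nextMean π n f ω ∂(M.law s₀ a₀ π) := by
  rw [law, Kernel.integral_trajMeasure_succ _ _ hf]
  refine integral_congr_ae (.of_forall fun ω => ?_)
  exact PMF.integral_eq_sum (M.nextLaw π n ω) fun x => f (Function.update ω (n + 1) x)

/-- `M.meanReward π k n` is the conditional expectation of the reward with index `n + k` given the
trajectory up to the index `n`. -/
def meanReward (M : DiscountedNMDP O A) (π : ASMPolicy O S A) :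
    ℕ → ℕ → Trajectory O S A → ℝ
  | 0, n => M.rewardAt n
  | k + 1, n => M.nextMean π n (M.meanReward π k (n + 1))

omit [MeasurableSpace O] [MeasurableSingletonClass O]
  [MeasurableSpace S] [MeasurableSingletonClass S]
  [MeasurableSpace A] [MeasurableSingletonClass A]

theorem dependsOn_meanReward (M : DiscountedNMDP O A) (π : ASMPolicy O S A) (k n : ℕ) :
    DependsOn (M.meanReward π k n) (Set.Iic n) := by
  induction k generalizing n with
  | zero => exact M.dependsOn_rewardAt le_rfl
  | succ k ih => exact M.dependsOn_nextMean π (ih (n + 1))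

theorem norm_meanReward_le (M : DiscountedNMDP O A) (π : ASMPolicy O S A) {C : ℝ}
    (hC : ∀ (n : ℕ) (o : Finset.Iic n → O) (a : Finset.Iic n → A), |M.reward n o a| ≤ C)
    (k n : ℕ) (ω : Trajectory O S A) : ‖M.meanReward π k n ω‖ ≤ C := by
  induction k generalizing n ω with
  | zero => exact hC n _ _
  | succ k ih => exact M.norm_nextMean_le π (ih (n + 1)) ω

/-- The conditional expectation of later rewards depends on the past only through the observations,
the actions and the current agent state. -/
theorem meanReward_congr (M : DiscountedNMDP O A) (π : ASMPolicy O S A) (k n : ℕ)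
    {ω ω' : Trajectory O S A} (ho : ω.obsUpTo n = ω'.obsUpTo n) (ha : ω.actUpTo n = ω'.actUpTo n)
    (hs : ω.state n = ω'.state n) : M.meanReward π k n ω = M.meanReward π k n ω' := by
  induction k generalizing n ω ω' with
  | zero => simp only [meanReward, rewardAt, ho, ha]
  | succ k ih =>
    refine Finset.sum_congr rfl fun x _ => ?_
    rw [M.nextLaw_congr π ho ha hs]
    congr 1
    -- Both histories receive the same entry `x`. Observations and actions therefore agree up to `n
    -- + 1`, and the new current state is that of `x`, even if earlier states differ.
    refine ih (n + 1) (funext fun i => ?_) (funext fun i => ?_) ?_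
    · rcases eq_or_ne (i : ℕ) (n + 1) with hi | hi
      · simp [Trajectory.obsUpTo, Trajectory.obs, hi]
      · have hin : (i : ℕ) ≤ n := by have := Finset.mem_Iic.1 i.2; omega
        have := congrFun ho ⟨i, Finset.mem_Iic.2 hin⟩
        simpa [Trajectory.obsUpTo, Trajectory.obs, Function.update_of_ne hi] using this
    · rcases eq_or_ne (i : ℕ) (n + 1) with hi | hi
      · simp [Trajectory.actUpTo, Trajectory.act, hi]
      · have hin : (i : ℕ) ≤ n := by have := Finset.mem_Iic.1 i.2; omega
        have := congrFun ha ⟨i, Finset.mem_Iic.2 hin⟩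
        simpa [Trajectory.actUpTo, Trajectory.act, Function.update_of_ne hi] using this
    · simp [Trajectory.state]

end DiscountedNMDP
end

noncomputable section

namespace DiscountedNMDP

/-! ### Reward-to-go, its conditional mean and the Q-function -/

section RewardToGo

variable {O S A : Type*} (M : DiscountedNMDP O A) {C : ℝ} {n : ℕ}

theorem summable_discount_mul (C : ℝ) : Summable fun k => M.γ ^ k * C :=
  (summable_geometric_of_lt_one M.γ_pos.le M.γ_lt_one).mul_right C

theorem norm_discount_mul_le {x : ℝ} (hx : ‖x‖ ≤ C) (k : ℕ) : ‖M.γ ^ k * x‖ ≤ M.γ ^ k * C := by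
  rw [norm_mul, norm_pow, Real.norm_of_nonneg M.γ_pos.le]
  exact mul_le_mul_of_nonneg_left hx (pow_nonneg M.γ_pos.le k)

theorem norm_tsum_discount_le {f : ℕ → ℝ} (hf : ∀ k, ‖f k‖ ≤ C) :
    ‖∑' k, M.γ ^ k * f k‖ ≤ (1 - M.γ)⁻¹ * C := by
  refine tsum_of_norm_bounded (g := fun k => M.γ ^ k * C) ?_
    fun k => M.norm_discount_mul_le (hf k) k
  exact (hasSum_geometric_of_lt_one M.γ_pos.le M.γ_lt_one).mul_right C

theorem summable_discount {f : ℕ → ℝ} (hf : ∀ k, ‖f k‖ ≤ C) : Summable fun k => M.γ ^ k * f k :=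
  (M.summable_discount_mul C).of_norm_bounded fun k => M.norm_discount_mul_le (hf k) k

theorem norm_discount_mul_smul_le {E : Type*} [NormedAddCommGroup E] [NormedSpace ℝ E] {x B : ℝ}
    {v : E} (hx : ‖x‖ ≤ C) (hv : ‖v‖ ≤ B) (k : ℕ) :
    ‖(M.γ ^ k * x) • v‖ ≤ M.γ ^ k * (C * B) := by
  rw [norm_smul, ← mul_assoc]
  exact mul_le_mul (M.norm_discount_mul_le hx k) hv (norm_nonneg _)
    (mul_nonneg (pow_nonneg M.γ_pos.le k) ((norm_nonneg x).trans hx))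

end RewardToGo

variable {O S A : Type*} [Fintype O] [MeasurableSpace O] [MeasurableSingletonClass O]
  [Fintype S] [MeasurableSpace S] [MeasurableSingletonClass S]
  [Fintype A] [MeasurableSpace A] [MeasurableSingletonClass A]
  {E : Type*} [NormedAddCommGroup E] [NormedSpace ℝ E]
  (M : DiscountedNMDP O A) (s₀ : S) (a₀ : A) (π : ASMPolicy O S A) {n : ℕ} {C B : ℝ}

omit [Fintype O] [MeasurableSingletonClass O] [Fintype S] [MeasurableSingletonClass S]
  [Fintype A] [MeasurableSingletonClass A] in
theorem stronglyMeasurable_tsum_discount {f : ℕ → Trajectory O S A → ℝ}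
    (hm : ∀ k, StronglyMeasurable (f k)) (hf : ∀ k ω, ‖f k ω‖ ≤ C) :
    StronglyMeasurable fun ω => ∑' k, M.γ ^ k * f k ω := by
  refine stronglyMeasurable_of_tendsto Filter.atTop
    (f := fun N ω => ∑ k ∈ Finset.range N, M.γ ^ k * f k ω)
    (fun N => Finset.stronglyMeasurable_fun_sum _ fun k _ => (hm k).const_mul _)
    (tendsto_pi_nhds.2 fun ω => ?_)
  exact (M.summable_discount fun k => hf k ω).hasSum.tendsto_sum_nat

theorem stronglyMeasurable_rewardToGo
    (hC : ∀ (n : ℕ) (o : Finset.Iic n → O) (a : Finset.Iic n → A), |M.reward n o a| ≤ C) (n : ℕ) :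
    StronglyMeasurable fun ω : Trajectory O S A => M.rewardToGo n ω :=
  M.stronglyMeasurable_tsum_discount (fun _ => (M.dependsOn_rewardAt le_rfl).stronglyMeasurable)
    fun _ _ => hC _ _ _

theorem integral_tsum_discount_smul [CompleteSpace E] {f : ℕ → Trajectory O S A → ℝ}
    {g : Trajectory O S A → E} (hm : ∀ k, StronglyMeasurable (f k)) (hf : ∀ k ω, ‖f k ω‖ ≤ C)
    (hg : StronglyMeasurable g) (hB : ∀ ω, ‖g ω‖ ≤ B) :
    ∫ ω, (∑' k, M.γ ^ k * f k ω) • g ω ∂(M.law s₀ a₀ π) =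
      ∑' k, ∫ ω, (M.γ ^ k * f k ω) • g ω ∂(M.law s₀ a₀ π) := by
  rw [← integral_tsum_of_norm_le (f := fun k ω => (M.γ ^ k * f k ω) • g ω)
    (fun k => ((hm k).const_mul _).smul hg) (M.summable_discount_mul (C * B))
    fun k ω => M.norm_discount_mul_smul_le (hf k ω) (hB ω) k]
  refine integral_congr_ae (.of_forall fun ω => ?_)
  exact ((M.summable_discount fun k => hf k ω).tsum_smul_const _).symm

/-- Iterated tower property: `g` is known at index `n`, hence at every later index, and comes out of
each `nextMean`. -/
theorem integral_rewardAt_smul [CompleteSpace E] (k : ℕ) {g : Trajectory O S A → E}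
    (hg : DependsOn g (Set.Iic n)) :
    ∫ ω, M.rewardAt (n + k) ω • g ω ∂(M.law s₀ a₀ π) =
      ∫ ω, M.meanReward π k n ω • g ω ∂(M.law s₀ a₀ π) := by
  induction k generalizing n with
  | zero => rfl
  | succ k ih =>
    have hg' : DependsOn g (Set.Iic (n + 1)) := hg.mono (Set.Iic_subset_Iic.2 n.le_succ)
    rw [show n + (k + 1) = n + 1 + k by omega, ih hg', M.integral_law_succ s₀ a₀ π
      ((M.dependsOn_meanReward π k (n + 1)).comp_left₂ hg' (· • ·))]
    refine integral_congr_ae (.of_forall fun ω => ?_)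
    exact M.nextMean_smul π _ hg ω

/-- The conditional expectation of the reward-to-go given the trajectory up to the index `n`. -/
def meanRewardToGo (n : ℕ) (ω : Trajectory O S A) : ℝ :=
  ∑' k, M.γ ^ k * M.meanReward π k n ω

omit [MeasurableSpace O] [MeasurableSingletonClass O]
  [MeasurableSpace S] [MeasurableSingletonClass S]
  [MeasurableSpace A] [MeasurableSingletonClass A] in
theorem dependsOn_meanRewardToGo (n : ℕ) :
    DependsOn (M.meanRewardToGo π n) (Set.Iic n) :=
  fun _ _ h => tsum_congr fun k => by rw [M.dependsOn_meanReward π k n h]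

/-- The characterizing property of a conditional expectation, tested against bounded functions of
the past; it is used with indicators and with scores. -/
theorem integral_rewardToGo_smul [CompleteSpace E]
    (hC : ∀ (n : ℕ) (o : Finset.Iic n → O) (a : Finset.Iic n → A), |M.reward n o a| ≤ C)
    {g : Trajectory O S A → E} (hg : DependsOn g (Set.Iic n)) (hB : ∀ ω, ‖g ω‖ ≤ B) :
    ∫ ω, M.rewardToGo n ω • g ω ∂(M.law s₀ a₀ π) =
      ∫ ω, M.meanRewardToGo π n ω • g ω ∂(M.law s₀ a₀ π) := by
  simp only [rewardToGo_eq, meanRewardToGo]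
  rw [M.integral_tsum_discount_smul s₀ a₀ π
      (fun k => (M.dependsOn_rewardAt (le_refl (n + k))).stronglyMeasurable)
      (fun k ω => hC _ _ _) hg.stronglyMeasurable hB,
    M.integral_tsum_discount_smul s₀ a₀ π
      (fun k => (M.dependsOn_meanReward π k n).stronglyMeasurable)
      (fun k ω => M.norm_meanReward_le π hC k n ω) hg.stronglyMeasurable hB]
  refine tsum_congr fun k => ?_
  simp only [mul_smul]
  rw [integral_smul, integral_smul, M.integral_rewardAt_smul s₀ a₀ π k hg]

/-- Along almost every trajectory, the Q-function is the conditional expectation of the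
reward-to-go given the whole past. -/
theorem qFunction_ae_eq
    (hC : ∀ (n : ℕ) (o : Finset.Iic n → O) (a : Finset.Iic n → A), |M.reward n o a| ≤ C) (n : ℕ) :
    ∀ᵐ ω ∂(M.law s₀ a₀ π), M.qFunction s₀ a₀ π n (ω.obsUpTo n) (ω.actUpTo n) (ω.state n) =
      M.meanRewardToGo π n ω := by
  let F : (Finset.Iic n → O) × (Finset.Iic n → A) × S → Set (Trajectory O S A) := fun y =>
    {ω | ω.obsUpTo n = y.1 ∧ ω.actUpTo n = y.2.1 ∧ ω.state n = y.2.2}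
  have hdep : ∀ y, DependsOn (fun ω => ω ∈ F y) (Set.Iic n) := fun y ω ω' h => by
    simp only [F, Set.mem_ofPred_eq, Trajectory.dependsOn_obsUpTo le_rfl h,
      Trajectory.dependsOn_actUpTo le_rfl h, Trajectory.dependsOn_state le_rfl h]
  have hF : ∀ y, MeasurableSet (F y) := fun y =>
    measurableSet_setOfPred.2 (hdep y).measurable
  -- There are finitely many conditioning events, so the null ones can be discarded together. For
  -- the remaining `ω`, the event containing it has positive probability, and `cond` is a genuine
  -- conditional law.
  have hae : ∀ᵐ ω ∂(M.law s₀ a₀ π), ∀ y, M.law s₀ a₀ π (F y) = 0 → ω ∉ F y :=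
    ae_all_iff.2 fun y => by
      by_cases h : M.law s₀ a₀ π (F y) = 0
      · filter_upwards [measure_eq_zero_iff_ae_notMem.1 h] with ω hω _ using hω
      · exact .of_forall fun _ h' => absurd h' h
  filter_upwards [hae] with ω hω
  set y : (Finset.Iic n → O) × (Finset.Iic n → A) × S := (ω.obsUpTo n, ω.actUpTo n, ω.state n)
  have hy : M.law s₀ a₀ π (F y) ≠ 0 := fun h => hω y h ⟨rfl, rfl, rfl⟩
  have hconst : ∀ ω' ∈ F y, M.meanRewardToGo π n ω' = M.meanRewardToGo π n ω :=
    fun ω' h => tsum_congr fun k => by rw [M.meanReward_congr π k n h.1 h.2.1 h.2.2]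
  -- Testing with the indicator of `F y`, on which the conditional mean is constant, identifies that
  -- constant as the average of the reward-to-go over `F y`.
  have key := M.integral_rewardToGo_smul s₀ a₀ π (n := n) (B := 1) hC
    (g := (F y).indicator fun _ => (1 : ℝ))
    (fun ω ω' h => by
      have := hdep y h
      simp only [eq_iff_iff] at this
      by_cases h1 : ω ∈ F y
      · simp [h1, this.1 h1]
      · simp [h1, mt this.2 h1])
    (fun ω => (norm_indicator_le_norm_self _ _).trans (by simp))
  have hind : ∀ f : Trajectory O S A → ℝ, ∫ ω, f ω • (F y).indicator (fun _ => (1 : ℝ)) ω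
      ∂(M.law s₀ a₀ π) = ∫ ω in F y, f ω ∂(M.law s₀ a₀ π) := fun f => by
    rw [← integral_indicator (hF y)]
    refine integral_congr_ae (.of_forall fun ω => ?_)
    by_cases h1 : ω ∈ F y <;> simp [h1]
  rw [hind, hind, setIntegral_congr_fun (hF y) hconst, setIntegral_const] at key
  calc M.qFunction s₀ a₀ π n (ω.obsUpTo n) (ω.actUpTo n) (ω.state n)
      = (M.law s₀ a₀ π (F y))⁻¹.toReal • ∫ ω in F y, M.rewardToGo n ω ∂(M.law s₀ a₀ π) := by
        rw [qFunction, ProbabilityTheory.cond, integral_smul_measure]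
    _ = M.meanRewardToGo π n ω := by
        rw [key, smul_smul, ENNReal.toReal_inv, measureReal_def, inv_mul_cancel₀, one_smul]
        exact ENNReal.toReal_ne_zero.2 ⟨hy, measure_ne_top _ _⟩

/-! ### Likelihood-ratio differentiation at a finite horizon -/

section Gradient

variable {d : ℕ} {π : EuclideanSpace ℝ (Fin d) → ASMPolicy O S A}

omit [MeasurableSpace O] [MeasurableSingletonClass O]
  [MeasurableSpace S] [MeasurableSingletonClass S]
  [MeasurableSpace A] [MeasurableSingletonClass A]
  [Fintype O] [Fintype S] [Fintype A] in
-- The observation law `q` is a constant factor in `θ`, so it contributes nothing to the logarithmic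
-- derivative.
theorem hasGradientAt_stepPMF {θ : EuclideanSpace ℝ (Fin d)}
    (hscore : ∀ s' a' o s a, HasGradientAt (fun θ => (π θ).prob s' a' o s a)
      ((π θ).prob s' a' o s a • ASMPolicy.score π θ s' a' o s a) θ)
    (q : PMF O) (s' : S) (a' : A) (x : O × S × A) :
    HasGradientAt (fun θ => (stepPMF (π θ) q s' a' x).toReal)
      ((stepPMF (π θ) q s' a' x).toReal • ASMPolicy.score π θ s' a' x.1 x.2.1 x.2.2) θ := by
  simp only [stepPMF_apply_toReal]
  convert (hasGradientAt_const θ (q x.1).toReal).fun_mul (hscore s' a' x.1 x.2.1 x.2.2) using 1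
  simp [mul_smul]

/-- Differentiation of the expectation of a function of finitely many trajectory entries. -/
theorem hasGradientAt_integral_law {θ : EuclideanSpace ℝ (Fin d)}
    (hscore : ∀ s' a' o s a, HasGradientAt (fun θ => (π θ).prob s' a' o s a)
      ((π θ).prob s' a' o s a • ASMPolicy.score π θ s' a' o s a) θ)
    {g : EuclideanSpace ℝ (Fin d) → Trajectory O S A → ℝ}
    {g' : Trajectory O S A → EuclideanSpace ℝ (Fin d)}
    (hg : ∀ θ, DependsOn (g θ) (Set.Iic n)) (hg' : DependsOn g' (Set.Iic n))
    (hgrad : ∀ ω, HasGradientAt (fun θ => g θ ω) (g' ω) θ) :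
    HasGradientAt (fun θ => ∫ ω, g θ ω ∂(M.law s₀ a₀ (π θ)))
      (∫ ω, (g' ω + g θ ω • ∑ t ∈ Finset.range (n + 1), ω.score s₀ a₀ π θ t)
        ∂(M.law s₀ a₀ (π θ))) θ := by
  -- Integrating out the last entry replaces `g θ` by its `nextMean`, which depends on `θ` even if
  -- `g` does not; hence the induction runs over `θ`-dependent `g`.
  induction n generalizing g g' with
  | zero =>
    have hdep : DependsOn (fun ω : Trajectory O S A =>
        g' ω + g θ ω • ∑ t ∈ Finset.range (0 + 1), ω.score s₀ a₀ π θ t) (Set.Iic 0) :=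
      hg'.comp_left₂ ((hg θ).comp_left₂ (.fun_sum fun t ht =>
        Trajectory.dependsOn_score s₀ a₀ π θ (by have := Finset.mem_range.1 ht; omega))
          (· • ·)) (· + ·)
    rw [M.integral_law_zero s₀ a₀ (π θ) hdep]
    simp only [M.integral_law_zero s₀ a₀ _ (hg _)]
    refine HasGradientAt.fun_sum fun x _ => ?_
    convert (hasGradientAt_stepPMF hscore M.init s₀ a₀ x).fun_mul (hgrad fun _ => x) using 1
    · simp
    · simp [Trajectory.score, Trajectory.prevState, Trajectory.prevAct, Trajectory.obs,
        Trajectory.state, Trajectory.act, smul_smul, mul_comm]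
  | succ n ih =>
    have hsc : DependsOn (fun ω : Trajectory O S A => ω.score s₀ a₀ π θ (n + 1))
      (Set.Iic (n + 1)) := Trajectory.dependsOn_score s₀ a₀ π θ le_rfl
    have hsum : DependsOn (fun ω : Trajectory O S A =>
        ∑ t ∈ Finset.range (n + 1), ω.score s₀ a₀ π θ t) (Set.Iic n) :=
      .fun_sum fun t ht =>
        Trajectory.dependsOn_score s₀ a₀ π θ (by have := Finset.mem_range.1 ht; omega)
    have hsum' : DependsOn (fun ω : Trajectory O S A =>
        ∑ t ∈ Finset.range (n + 1), ω.score s₀ a₀ π θ t) (Set.Iic (n + 1)) :=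
      hsum.mono (Set.Iic_subset_Iic.2 n.le_succ)
    have hf : DependsOn (fun ω : Trajectory O S A =>
        g' ω + g θ ω • ω.score s₀ a₀ π θ (n + 1)) (Set.Iic (n + 1)) :=
      hg'.comp_left₂ ((hg θ).comp_left₂ hsc (· • ·)) (· + ·)
    have hf' : DependsOn (fun ω : Trajectory O S A =>
        g θ ω • ∑ t ∈ Finset.range (n + 1), ω.score s₀ a₀ π θ t) (Set.Iic (n + 1)) :=
      (hg θ).comp_left₂ hsum' (· • ·)
    -- The score at `n + 1` stays inside the conditional mean; the earlier ones are known at `n` and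
    -- come out. The result has the shape of the induction hypothesis.
    have hμ : ∫ ω, (g' ω + g θ ω • ∑ t ∈ Finset.range (n + 1 + 1), ω.score s₀ a₀ π θ t)
        ∂(M.law s₀ a₀ (π θ)) =
        ∫ ω, (M.nextMean (π θ) n (fun ω => g' ω + g θ ω • ω.score s₀ a₀ π θ (n + 1)) ω +
          M.nextMean (π θ) n (g θ) ω • ∑ t ∈ Finset.range (n + 1), ω.score s₀ a₀ π θ t)
        ∂(M.law s₀ a₀ (π θ)) := by
      rw [integral_add ((M.dependsOn_nextMean (π θ) hf).integrable _)
        (((M.dependsOn_nextMean (π θ) (hg θ)).comp_left₂ hsum (· • ·)).integrable _),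
        ← M.integral_law_succ s₀ a₀ (π θ) hf]
      simp only [← M.nextMean_smul (π θ) (g θ) hsum]
      rw [← M.integral_law_succ s₀ a₀ (π θ) hf',
        ← integral_add (hf.integrable _) (hf'.integrable _)]
      refine integral_congr_ae (.of_forall fun ω => ?_)
      simp only [Finset.sum_range_succ _ (n + 1), smul_add]
      abel
    rw [hμ]
    simp only [M.integral_law_succ s₀ a₀ _ (hg _)]
    refine ih (fun θ => M.dependsOn_nextMean (π θ) (hg θ)) (M.dependsOn_nextMean (π θ) hf)
      fun ω => ?_
    refine HasGradientAt.fun_sum fun x _ => ?_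
    -- By the product rule for the probability of `x` times `g`, differentiating `nextMean` yields
    -- the `nextMean` of `g' + g • score_{n+1}`.
    convert (hasGradientAt_stepPMF hscore (M.trans n (ω.obsUpTo n) (ω.actUpTo n)) (ω.state n)
      (ω.act n) x).fun_mul (hgrad (Function.update ω (n + 1) x)) using 1
    · simp [nextLaw]
    · simp [Trajectory.score, Trajectory.prevState, Trajectory.prevAct, Trajectory.obs,
        Trajectory.state, Trajectory.act, smul_smul, mul_comm, nextLaw]

end Gradient

end DiscountedNMDP
end

noncomputable section

/-! ### Gradient of the infinite-horizon value -/

namespace DiscountedNMDP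

variable {O S A : Type*} [Fintype O] [MeasurableSpace O] [MeasurableSingletonClass O]
  [Fintype S] [MeasurableSpace S] [MeasurableSingletonClass S]
  [Fintype A] [MeasurableSpace A] [MeasurableSingletonClass A]
  (M : DiscountedNMDP O A) (s₀ : S) (a₀ : A) {C B : ℝ}
  {d : ℕ} {π : EuclideanSpace ℝ (Fin d) → ASMPolicy O S A}

theorem value_eq_tsum (π : ASMPolicy O S A)
    (hC : ∀ (n : ℕ) (o : Finset.Iic n → O) (a : Finset.Iic n → A), |M.reward n o a| ≤ C) :
    M.value s₀ a₀ π = ∑' l, M.γ ^ l * ∫ ω, M.rewardAt l ω ∂(M.law s₀ a₀ π) := by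
  simp only [value, rewardToGo_eq, zero_add]
  rw [integral_tsum_of_norm_le (f := fun l ω => M.γ ^ l * M.rewardAt l ω)
    (fun l => (M.dependsOn_rewardAt le_rfl).stronglyMeasurable.const_mul _)
    (M.summable_discount_mul C) fun l ω => M.norm_discount_mul_le (hC _ _ _) l]
  simp only [integral_const_mul]

theorem hasGradientAt_value_tsum
    (hscore : ∀ θ s' a' o s a, HasGradientAt (fun θ => (π θ).prob s' a' o s a)
      ((π θ).prob s' a' o s a • ASMPolicy.score π θ s' a' o s a) θ)
    (hC : ∀ (n : ℕ) (o : Finset.Iic n → O) (a : Finset.Iic n → A), |M.reward n o a| ≤ C)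
    (hB : ∀ θ s' a' o s a, ‖ASMPolicy.score π θ s' a' o s a‖ ≤ B)
    (θ : EuclideanSpace ℝ (Fin d)) :
    HasGradientAt (fun θ => M.value s₀ a₀ (π θ))
      (∑' l, M.γ ^ l • ∫ ω, M.rewardAt l ω • ∑ t ∈ Finset.range (l + 1), ω.score s₀ a₀ π θ t
        ∂(M.law s₀ a₀ (π θ))) θ := by
  simp only [M.value_eq_tsum s₀ a₀ _ hC]
  have hbound : ∀ l (ω : Trajectory O S A), ‖M.rewardAt l ω‖ ≤ C := fun l ω => hC _ _ _
  -- The factor `l + 1` counts the scores that multiply the reward with index `l`.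
  have hu : Summable fun l : ℕ => M.γ ^ l * (C * ((l + 1) * B)) := by
    have h1 : Summable fun l : ℕ => (l : ℝ) * M.γ ^ l := by
      simpa using summable_pow_mul_geometric_of_norm_lt_one 1
        (by rw [Real.norm_of_nonneg M.γ_pos.le]; exact M.γ_lt_one : ‖M.γ‖ < 1)
    refine ((h1.mul_right (C * B)).add (M.summable_discount_mul (C * B))).congr fun l => ?_
    ring
  have hint : ∀ (θ : EuclideanSpace ℝ (Fin d)) (l : ℕ),
      ‖∫ ω, M.rewardAt l ω ∂(M.law s₀ a₀ (π θ))‖ ≤ C :=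
    fun θ l => norm_integral_le_of_forall_norm_le (hbound l)
  refine hasGradientAt_tsum
    (f := fun l θ => M.γ ^ l * ∫ ω, M.rewardAt l ω ∂(M.law s₀ a₀ (π θ)))
    (f' := fun l θ => M.γ ^ l • ∫ ω, M.rewardAt l ω •
      ∑ t ∈ Finset.range (l + 1), ω.score s₀ a₀ π θ t ∂(M.law s₀ a₀ (π θ)))
    hu (fun l θ => ?_) (fun l θ => ?_) (x₀ := θ) (M.summable_discount (hint θ)) θ
  · have h := M.hasGradientAt_integral_law s₀ a₀ (n := l) (hscore θ)
      (g := fun _ => M.rewardAt l) (g' := fun _ => 0) (fun _ => M.dependsOn_rewardAt le_rfl)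
      (fun _ _ _ => rfl) (fun ω => hasGradientAt_const _ _)
    simpa only [zero_add, smul_zero, add_zero] using
      (hasGradientAt_const θ (M.γ ^ l)).fun_mul h
  · rw [norm_smul, norm_pow, Real.norm_of_nonneg M.γ_pos.le]
    refine mul_le_mul_of_nonneg_left ?_ (pow_nonneg M.γ_pos.le l)
    have : ∀ ω : Trajectory O S A,
        ‖M.rewardAt l ω • ∑ t ∈ Finset.range (l + 1), ω.score s₀ a₀ π θ t‖ ≤
          C * ((l + 1) * B) := fun ω => by
      rw [norm_smul]
      refine mul_le_mul (hbound l ω) ?_ (norm_nonneg _) ((norm_nonneg _).trans (hbound l ω))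
      refine (norm_sum_le_of_le _ fun t _ => hB θ _ _ _ _ _).trans ?_
      simp
    exact norm_integral_le_of_forall_norm_le this

/-- The gradient of the value in the reward-to-go form, term by term. -/
theorem hasGradientAt_value
    (hscore : ∀ θ s' a' o s a, HasGradientAt (fun θ => (π θ).prob s' a' o s a)
      ((π θ).prob s' a' o s a • ASMPolicy.score π θ s' a' o s a) θ)
    (hC : ∀ (n : ℕ) (o : Finset.Iic n → O) (a : Finset.Iic n → A), |M.reward n o a| ≤ C)
    (hB : ∀ θ s' a' o s a, ‖ASMPolicy.score π θ s' a' o s a‖ ≤ B)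
    (θ : EuclideanSpace ℝ (Fin d)) :
    HasGradientAt (fun θ => M.value s₀ a₀ (π θ))
      (∑' t, ∫ ω, (M.γ ^ t * M.rewardToGo t ω) • ω.score s₀ a₀ π θ t
        ∂(M.law s₀ a₀ (π θ))) θ := by
  have hbound : ∀ l (ω : Trajectory O S A), ‖M.rewardAt l ω‖ ≤ C := fun l ω => hC _ _ _
  have hsc : ∀ t, DependsOn (fun ω : Trajectory O S A => ω.score s₀ a₀ π θ t) (Set.Iic t) :=
    fun t => Trajectory.dependsOn_score s₀ a₀ π θ le_rfl
  -- `b t k` pairs the score at `t` with the reward `k` steps later; its discount `γ^(t + k)` makes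
  -- the double family absolutely summable.
  let b : ℕ → ℕ → EuclideanSpace ℝ (Fin d) := fun t k =>
    ∫ ω, (M.γ ^ (t + k) * M.rewardAt (t + k) ω) • ω.score s₀ a₀ π θ t ∂(M.law s₀ a₀ (π θ))
  have hb : Summable fun p : ℕ × ℕ => b p.1 p.2 := by
    refine (summable_geometric_add M.γ_pos.le M.γ_lt_one (C * B)).of_norm_bounded fun p => ?_
    exact norm_integral_le_of_forall_norm_le fun ω =>
      M.norm_discount_mul_smul_le (hbound (p.1 + p.2) ω) (hB θ _ _ _ _ _) (p.1 + p.2)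
  convert M.hasGradientAt_value_tsum s₀ a₀ hscore hC hB θ using 1
  calc ∑' t, ∫ ω, (M.γ ^ t * M.rewardToGo t ω) • ω.score s₀ a₀ π θ t ∂(M.law s₀ a₀ (π θ))
      = ∑' t, ∑' k, b t k := tsum_congr fun t => by
        simp only [mul_smul, rewardToGo_eq]
        rw [integral_smul, M.integral_tsum_discount_smul s₀ a₀ (π θ)
          (fun k => (M.dependsOn_rewardAt (le_refl (t + k))).stronglyMeasurable)
          (fun k ω => hbound _ _) (hsc t).stronglyMeasurable fun ω => hB θ _ _ _ _ _,
          ← tsum_const_smul'']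
        refine tsum_congr fun k => ?_
        rw [← integral_smul]
        refine integral_congr_ae (.of_forall fun ω => ?_)
        simp only [smul_smul, pow_add, mul_assoc]
    _ = ∑' l, ∑ t ∈ Finset.range (l + 1), b t (l - t) := (tsum_sum_range_eq_tsum_tsum hb).symm
    _ = _ := tsum_congr fun l => by
        simp only [Finset.smul_sum]
        rw [integral_finsetSum, Finset.smul_sum]
        · refine Finset.sum_congr rfl fun t ht => ?_
          have : t + (l - t) = l := by have := Finset.mem_range.1 ht; omega
          simp only [b, this, mul_smul, integral_smul]
        · intro t ht
          exact ((M.dependsOn_rewardAt le_rfl).comp_left₂ (Trajectory.dependsOn_score s₀ a₀ π θ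
            (by have := Finset.mem_range.1 ht; omega)) (· • ·)).integrable (n := l) _

end DiscountedNMDP

/-! ### Policies with constant support -/

/-- If the support of a differentiable family of policies is constant, the gradient of each
probability is the probability times the score; on the complement of the support, the score
vanishes. -/
theorem ASMPolicy.hasGradientAt_prob {O S A : Type*} {d : ℕ}
    {π : EuclideanSpace ℝ (Fin d) → ASMPolicy O S A}
    (hdiff : ∀ (s' : S) (a' : A) (o : O) (s : S) (a : A),
      Differentiable ℝ fun θ => (π θ).prob s' a' o s a)
    (hzero : ∀ θ θ' s' a' o s a, (π θ).prob s' a' o s a = 0 → (π θ').prob s' a' o s a = 0)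
    (θ : EuclideanSpace ℝ (Fin d)) (s' : S) (a' : A) (o : O) (s : S) (a : A) :
    HasGradientAt (fun θ => (π θ).prob s' a' o s a)
      ((π θ).prob s' a' o s a • ASMPolicy.score π θ s' a' o s a) θ :=
  hasGradientAt_smul_gradient_log (hdiff s' a' o s a) fun h θ' => hzero θ θ' s' a' o s a h

theorem ASMPolicy.prob_eq_zero_of_support_eq {O S A : Type*} {π π' : ASMPolicy O S A} {s' : S}
    {a' : A} {o : O} (h : (π.kernel s' a' o).support = (π'.kernel s' a' o).support) {s : S} {a : A}
    (h0 : π.prob s' a' o s a = 0) : π'.prob s' a' o s a = 0 := by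
  have h1 : (π.kernel s' a' o) (s, a) = 0 :=
    (ENNReal.toReal_eq_zero_iff _).1 h0 |>.resolve_right (PMF.apply_ne_top _ _)
  rw [PMF.apply_eq_zero_iff, h, ← PMF.apply_eq_zero_iff] at h1
  rw [ASMPolicy.prob, h1, ENNReal.toReal_zero]

/-- Off the support the probability is zero for every parameter, so with `Real.log 0 = 0` the score
is zero there. The bound `|G|` covers this case whatever the sign of `G`. -/
theorem ASMPolicy.norm_score_le {O S A : Type*} {d : ℕ}
    {π : EuclideanSpace ℝ (Fin d) → ASMPolicy O S A}
    (hzero : ∀ θ θ' s' a' o s a, (π θ).prob s' a' o s a = 0 → (π θ').prob s' a' o s a = 0)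
    {G : ℝ} (hG : ∀ (θ : EuclideanSpace ℝ (Fin d)) (s' : S) (a' : A) (o : O) (s : S) (a : A),
      0 < (π θ).prob s' a' o s a → ‖ASMPolicy.score π θ s' a' o s a‖ ≤ G)
    (θ : EuclideanSpace ℝ (Fin d)) (s' : S) (a' : A) (o : O) (s : S) (a : A) :
    ‖ASMPolicy.score π θ s' a' o s a‖ ≤ |G| := by
  rcases (ENNReal.toReal_nonneg : 0 ≤ (π θ).prob s' a' o s a).eq_or_lt with h | h
  · have : (fun θ' => Real.log ((π θ').prob s' a' o s a)) = fun _ => 0 := by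
      funext θ'
      rw [hzero θ θ' s' a' o s a h.symm, Real.log_zero]
    simp [ASMPolicy.score, this]
  · exact (hG θ s' a' o s a h).trans (le_abs_self G)

end

/-! ### The policy gradient theorem -/

theorem theorem2 {O S A : Type*}
    [Finite O] [MeasurableSpace O] [MeasurableSingletonClass O]
    [Finite S] [MeasurableSpace S] [MeasurableSingletonClass S]
    [Finite A] [MeasurableSpace A] [MeasurableSingletonClass A]
    (M : DiscountedNMDP O A) (s₀ : S) (a₀ : A) {d : ℕ}
    (π : EuclideanSpace ℝ (Fin d) → ASMPolicy O S A)
    -- the kernel is differentiable in the parameter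
    (hdiff : ∀ (s' : S) (a' : A) (o : O) (s : S) (a : A),
      Differentiable ℝ fun θ => (π θ).prob s' a' o s a)
    -- its support does not depend on the parameter
    (hsupp : ∀ (θ₁ θ₂ : EuclideanSpace ℝ (Fin d)) (s' : S) (a' : A) (o : O),
      ((π θ₁).kernel s' a' o).support = ((π θ₂).kernel s' a' o).support)
    -- the rewards are bounded
    (rmax : ℝ) (hr : ∀ (n : ℕ) (o : Finset.Iic n → O) (a : Finset.Iic n → A),
      |M.reward n o a| ≤ rmax)
    -- the score is bounded wherever it is defined
    (G : ℝ) (hG : ∀ (θ : EuclideanSpace ℝ (Fin d)) (s' : S) (a' : A) (o : O) (s : S) (a : A),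
      0 < (π θ).prob s' a' o s a → ‖ASMPolicy.score π θ s' a' o s a‖ ≤ G)
    (θ : EuclideanSpace ℝ (Fin d)) :
    -- all series and expectations below converge
    (Integrable (fun ω => M.rewardToGo 0 ω) (M.law s₀ a₀ (π θ)) ∧
      (∀ᵐ ω ∂(M.law s₀ a₀ (π θ)), Summable fun n : ℕ =>
        (M.γ ^ n * M.rewardToGo n ω) • ω.score s₀ a₀ π θ n) ∧
      Integrable (fun ω => ∑' n : ℕ,
        (M.γ ^ n * M.rewardToGo n ω) • ω.score s₀ a₀ π θ n) (M.law s₀ a₀ (π θ)) ∧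
      (∀ᵐ ω ∂(M.law s₀ a₀ (π θ)), Summable fun n : ℕ =>
        (M.γ ^ n * M.qFunction s₀ a₀ (π θ) n (ω.obsUpTo n) (ω.actUpTo n) (ω.state n)) •
          ω.score s₀ a₀ π θ n) ∧
      Integrable (fun ω => ∑' n : ℕ,
        (M.γ ^ n * M.qFunction s₀ a₀ (π θ) n (ω.obsUpTo n) (ω.actUpTo n) (ω.state n)) •
          ω.score s₀ a₀ π θ n) (M.law s₀ a₀ (π θ))) ∧
    -- the objective is differentiable, and its gradient has the reward-to-go form
    HasGradientAt (fun θ' => M.value s₀ a₀ (π θ'))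
      (∫ ω, ∑' n : ℕ, (M.γ ^ n * M.rewardToGo n ω) • ω.score s₀ a₀ π θ n
        ∂(M.law s₀ a₀ (π θ))) θ ∧
    -- and the Q-function form
    HasGradientAt (fun θ' => M.value s₀ a₀ (π θ'))
      (∫ ω, ∑' n : ℕ,
        (M.γ ^ n * M.qFunction s₀ a₀ (π θ) n (ω.obsUpTo n) (ω.actUpTo n) (ω.state n)) •
          ω.score s₀ a₀ π θ n
        ∂(M.law s₀ a₀ (π θ))) θ := by
  classical
  have := Fintype.ofFinite O
  have := Fintype.ofFinite S
  have := Fintype.ofFinite A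
  have hzero : ∀ θ θ' s' a' o s a, (π θ).prob s' a' o s a = 0 → (π θ').prob s' a' o s a = 0 :=
    fun θ θ' s' a' o _ _ => ASMPolicy.prob_eq_zero_of_support_eq (hsupp θ θ' s' a' o)
  have hB := ASMPolicy.norm_score_le hzero hG
  have hsc : ∀ n, DependsOn (fun ω : Trajectory O S A => ω.score s₀ a₀ π θ n) (Set.Iic n) :=
    fun n => Trajectory.dependsOn_score s₀ a₀ π θ le_rfl
  have hR : ∀ n (ω : Trajectory O S A), ‖M.rewardToGo n ω‖ ≤ (1 - M.γ)⁻¹ * rmax :=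
    fun n ω => M.norm_tsum_discount_le fun k => hr _ _ _
  have hW : ∀ n (ω : Trajectory O S A), ‖M.meanRewardToGo (π θ) n ω‖ ≤ (1 - M.γ)⁻¹ * rmax :=
    fun n ω => M.norm_tsum_discount_le fun k => M.norm_meanReward_le (π θ) hr k n ω
  have hRm : ∀ n, StronglyMeasurable fun ω : Trajectory O S A => M.rewardToGo n ω :=
    M.stronglyMeasurable_rewardToGo hr
  have hRsm : ∀ n, StronglyMeasurable fun ω : Trajectory O S A =>
      (M.γ ^ n * M.rewardToGo n ω) • ω.score s₀ a₀ π θ n :=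
    fun n => ((hRm n).const_mul _).smul (hsc n).stronglyMeasurable
  have hWsm : ∀ n, StronglyMeasurable fun ω : Trajectory O S A =>
      (M.γ ^ n * M.meanRewardToGo (π θ) n ω) • ω.score s₀ a₀ π θ n :=
    fun n => ((M.dependsOn_meanRewardToGo (π θ) n).stronglyMeasurable.const_mul _).smul
      (hsc n).stronglyMeasurable
  have hRb : ∀ n (ω : Trajectory O S A), ‖(M.γ ^ n * M.rewardToGo n ω) • ω.score s₀ a₀ π θ n‖ ≤
      M.γ ^ n * ((1 - M.γ)⁻¹ * rmax * |G|) :=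
    fun n ω => M.norm_discount_mul_smul_le (hR n ω) (hB θ _ _ _ _ _) n
  have hWb : ∀ n (ω : Trajectory O S A),
      ‖(M.γ ^ n * M.meanRewardToGo (π θ) n ω) • ω.score s₀ a₀ π θ n‖ ≤
      M.γ ^ n * ((1 - M.γ)⁻¹ * rmax * |G|) :=
    fun n ω => M.norm_discount_mul_smul_le (hW n ω) (hB θ _ _ _ _ _) n
  have hu := M.summable_discount_mul ((1 - M.γ)⁻¹ * rmax * |G|)
  have hQ : ∀ᵐ ω ∂(M.law s₀ a₀ (π θ)), ∀ n,
      M.qFunction s₀ a₀ (π θ) n (ω.obsUpTo n) (ω.actUpTo n) (ω.state n) =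
        M.meanRewardToGo (π θ) n ω := ae_all_iff.2 (M.qFunction_ae_eq s₀ a₀ (π θ) hr)
  have hQsum : (fun ω => ∑' n : ℕ, (M.γ ^ n * M.meanRewardToGo (π θ) n ω) • ω.score s₀ a₀ π θ n)
      =ᵐ[M.law s₀ a₀ (π θ)] fun ω => ∑' n : ℕ,
        (M.γ ^ n * M.qFunction s₀ a₀ (π θ) n (ω.obsUpTo n) (ω.actUpTo n) (ω.state n)) •
          ω.score s₀ a₀ π θ n := by
    filter_upwards [hQ] with ω hω
    simp only [hω]
  have hgrad : HasGradientAt (fun θ' => M.value s₀ a₀ (π θ'))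
      (∫ ω, ∑' n : ℕ, (M.γ ^ n * M.rewardToGo n ω) • ω.score s₀ a₀ π θ n
        ∂(M.law s₀ a₀ (π θ))) θ := by
    rw [integral_tsum_of_norm_le hRsm hu hRb]
    exact M.hasGradientAt_value s₀ a₀ (ASMPolicy.hasGradientAt_prob hdiff hzero) hr hB θ
  refine ⟨⟨?_, ?_, ?_, ?_, ?_⟩, hgrad, ?_⟩
  · exact .of_bound (hRm 0).aestronglyMeasurable _ (.of_forall (hR 0))
  · exact .of_forall fun ω => hu.of_norm_bounded fun n => hRb n ω
  · exact integrable_tsum_of_norm_le hRsm hu hRb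
  · filter_upwards [hQ] with ω hω
    simp only [hω]
    exact hu.of_norm_bounded fun n => hWb n ω
  · exact (integrable_tsum_of_norm_le hWsm hu hWb).congr hQsum
  · convert hgrad using 1
    -- The Q-function is exchanged for the conditional mean almost surely; the two forms then agree
    -- term by term, with the score as test function.
    rw [← integral_congr_ae hQsum, integral_tsum_of_norm_le hWsm hu hWb,
      integral_tsum_of_norm_le hRsm hu hRb]
    refine tsum_congr fun n => ?_
    simp only [mul_smul, integral_smul]
    rw [M.integral_rewardToGo_smul s₀ a₀ (π θ) hr (hsc n) fun ω => hB θ _ _ _ _ _]
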